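/- Let $\mathcal S=(\mathcal P,\mathcal L)$ be a finite linear space: $\mathcal P$ is a finite set of points and $\mathcal L$ is a non-empty set of subsets of $\mathcal P$, called lines, such that every line has at least two points and any two distinct points lie in exactly one line. Suppose that $\mathcal S$ is non-trivial, that is, it has more than one line and not all of its lines have exactly two points. Let $G$ be a group of permutations of $\mathcal P$ that leave $\mathcal L$ invariant, and suppose that $G$ is transitive on $\mathcal L$ (so that all lines have the same number $k$ of points and all points lie on the same number $r$ of lines). Let $\mathfrak C$ be a $G$-invariant partition of $\mathcal P$ that is non-trivial, that is, $\mathfrak C$ is neither the partition into singletons nor the partition with a single class. If $\gcd(k,r)\le 8$, then $G$ is 2-step imprimitive on $\mathcal P$ relative to $\mathfrak C$. That is, $G$ is transitive on $\mathcal P$, and $\mathfrak C$ is a non-trivial $G$-invariant partition which is both minimal (the only $G$-invariant partition of $\mathcal P$ strictly refining $\mathfrak C$ is the partition into singletons) and maximal (the only $G$-invariant partition of $\mathcal P$ strictly coarser than $\mathfrak C$ is the partition with a single class). -/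

import Mathlib

/-- A linear space on the point set `P`: a non-empty set of lines (subsets of `P`) such that every
line has at least two points and any two distinct points lie in exactly one line. -/
structure LinearSpace (P : Type*) where
  lines : Set (Set P)
  lines_nonempty : lines.Nonempty
  two_points : ∀ ℓ ∈ lines, ∃ p ∈ ℓ, ∃ q ∈ ℓ, p ≠ q
  existsUnique_line : ∀ p q : P, p ≠ q → ∃! ℓ, ℓ ∈ lines ∧ p ∈ ℓ ∧ q ∈ ℓ

namespace LinearSpace

variable {P : Type*}

/-- A linear space is trivial if it has only one line, or if all its lines have only two points. -/
def IsTrivial (S : LinearSpace P) : Prop :=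
  (∃ ℓ, S.lines = {ℓ}) ∨ ∀ ℓ ∈ S.lines, ℓ.ncard = 2

/-- The automorphism group: all permutations of the points that leave the set of lines
invariant. -/
def aut (S : LinearSpace P) : Subgroup (Equiv.Perm P) where
  carrier := {g | ∀ ℓ : Set P, g '' ℓ ∈ S.lines ↔ ℓ ∈ S.lines}
  one_mem' := fun ℓ => by simp
  mul_mem' := by
    intro g h hg hh ℓ
    rw [Equiv.Perm.coe_mul, Set.image_comp]
    exact (hg _).trans (hh _)
  inv_mem' := by
    intro g hg ℓ
    have h := hg ((g⁻¹ : Equiv.Perm P) '' ℓ)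
    rw [← Set.image_comp, ← Equiv.Perm.coe_mul, mul_inv_cancel, Equiv.Perm.coe_one,
      Set.image_id] at h
    exact h.symm

/-- The group `G` is transitive on the lines. -/
def IsLineTransitive (S : LinearSpace P) (G : Subgroup (Equiv.Perm P)) : Prop :=
  ∀ ℓ ∈ S.lines, ∀ m ∈ S.lines, ∃ g ∈ G, g '' ℓ = m

/-- Every line has exactly `k` points. -/
def HasLineSize (S : LinearSpace P) (k : ℕ) : Prop :=
  ∀ ℓ ∈ S.lines, ℓ.ncard = k

/-- Every point lies on exactly `r` lines. -/
def HasLinesPerPoint (S : LinearSpace P) (r : ℕ) : Prop :=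
  ∀ p : P, {ℓ ∈ S.lines | p ∈ ℓ}.ncard = r

end LinearSpace

namespace PointPartition

variable {X : Type*}

/-- The partition with all classes of size one. -/
def discrete (X : Type*) : Set (Set X) := {C | ∃ a : X, C = {a}}

/-- The partition with a single class. -/
def allInOne (X : Type*) : Set (Set X) := {Set.univ}

/-- A non-trivial partition neither consists of only one class nor of one-element classes only. -/
def IsNontrivial (𝒞 : Set (Set X)) : Prop :=
  𝒞 ≠ discrete X ∧ 𝒞 ≠ allInOne X

/-- `𝒞` is a partition of `X` (non-empty pairwise disjoint classes covering `X`), and every element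
of `G` maps every class to a class. -/
def IsInvariantPartition (G : Subgroup (Equiv.Perm X)) (𝒞 : Set (Set X)) : Prop :=
  Setoid.IsPartition 𝒞 ∧ ∀ g ∈ G, ∀ C ∈ 𝒞, g '' C ∈ 𝒞

/-- Every class of `𝒞` is contained in a class of `𝒟`. -/
def Refines (𝒞 𝒟 : Set (Set X)) : Prop :=
  ∀ C ∈ 𝒞, ∃ D ∈ 𝒟, C ⊆ D

/-- Among the `G`-invariant partitions, the only strict refinement of `𝒞` is the discrete one. -/
def IsMinimal (G : Subgroup (Equiv.Perm X)) (𝒞 : Set (Set X)) : Prop :=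
  ∀ 𝒟, IsInvariantPartition G 𝒟 → Refines 𝒟 𝒞 → 𝒟 ≠ 𝒞 → 𝒟 = discrete X

/-- Among the `G`-invariant partitions, the only one strictly coarser than `𝒞` is the all-in-one
partition. -/
def IsMaximal (G : Subgroup (Equiv.Perm X)) (𝒞 : Set (Set X)) : Prop :=
  ∀ 𝒟, IsInvariantPartition G 𝒟 → Refines 𝒞 𝒟 → 𝒟 ≠ 𝒞 → 𝒟 = allInOne X

/-- `G` is transitive on `X`, and `𝒞` is a non-trivial `G`-invariant partition that is both minimal
and maximal among the `G`-invariant partitions. -/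
def IsTwoStepImprimitive (G : Subgroup (Equiv.Perm X)) (𝒞 : Set (Set X)) : Prop :=
  (∀ a b : X, ∃ g ∈ G, g a = b) ∧ IsInvariantPartition G 𝒞 ∧ IsNontrivial 𝒞 ∧
    IsMinimal G 𝒞 ∧ IsMaximal G 𝒞

end PointPartition

/-! Failure of minimality or maximality gives two nested invariant partitions with class sizes `1 <
c < C < v`, where `c ∣ C ∣ v`. Counting inner pairs (`exists_even_mul_eq`) gives `k (c - 1) = r N`
with `N` even, and likewise for `C`. Put `k = γ K`, `r = γ R` with `K`, `R` coprime. Then `c`, `C`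
and `v` are all `1` modulo `R`, so `v` is a product of three factors `1 + R a`, `1 + R b`, `1 + R
d`, each at least `1 + R`. But `v = 1 + r (k - 1)` is only quadratic in `R` for bounded `γ`, since
`K ≤ R` by Fisher. So `γ ≤ 8` bounds `R`, and `not_hasParameterChain` rules out the finitely many
remaining cases. -/

/-! ### Arithmetic of a chain of class sizes. -/

/-- `(1 + R a) (1 + R b)` properly divides `v = 1 + R γ (γ K - 1)`, and `K a` and
`K (a + b + R a b)` are even. -/
def IsParameterChain (γ R K a b : ℕ) : Prop :=
  0 < a ∧ (K * a) % 2 = 0 ∧ 0 < b ∧ (K * (a + b + R * a * b)) % 2 = 0 ∧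
    (1 + R * (γ * (γ * K - 1))) % ((1 + R * a) * (1 + R * b)) = 0 ∧
    (1 + R * a) * (1 + R * b) * R < 1 + R * (γ * (γ * K - 1))

instance (γ R K a b : ℕ) : Decidable (IsParameterChain γ R K a b) :=
  inferInstanceAs (Decidable (_ ∧ _))

/-- Some `a, b < 17` form a parameter chain for `v = 1 + R γ (γ K - 1)`, where `K ≤ R` divides `v`
and `v ≥ (1 + R) ^ 3`. -/
def HasParameterChain (γ R K : ℕ) : Prop :=
  (K ≤ R ∧ R * R + 3 * R + 3 + γ ≤ γ * γ * K ∧ (1 + R * (γ * (γ * K - 1))) % K = 0) ∧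
    ∃ a < 17, ∃ b < 17, IsParameterChain γ R K a b

instance (γ R K : ℕ) : Decidable (HasParameterChain γ R K) :=
  inferInstanceAs (Decidable (_ ∧ _))

/-- A finite search. The conditions on `γ`, `R`, `K` alone are tested before any `a`, `b` is tried;
coprimality of `K` and `R` is not imposed. -/
theorem not_hasParameterChain : ∀ γ < 9, ∀ R < 61, ∀ K < 61, ¬ HasParameterChain γ R K := by
  decide +kernel

/-- Modulo `R`, if `m` and `m n` are `1`, so is `n`. This extracts the three factors of `v` in turn.
-/
theorem eq_one_add_mul_of_dvd_mul_sub_one {R m n : ℕ} (hn : 1 < n)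
    (hm : R ∣ m - 1) (hm' : 0 < m) (h : R ∣ m * n - 1) : ∃ b, 0 < b ∧ n = 1 + R * b := by
  have h1 : m * n - 1 = (m - 1) * n + (n - 1) := by
    obtain ⟨m, rfl⟩ : ∃ m', m = m' + 1 := ⟨m - 1, by omega⟩
    obtain ⟨n, rfl⟩ : ∃ n', n = n' + 1 := ⟨n - 1, by omega⟩
    simp only [Nat.add_sub_cancel]
    have : (m + 1) * (n + 1) = m * (n + 1) + n + 1 := by ring
    omega
  rw [h1] at h
  obtain ⟨b, hb⟩ := (Nat.dvd_add_right (hm.mul_right n)).1 h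
  refine ⟨b, ?_, by omega⟩
  rcases Nat.eq_zero_or_pos b with rfl | h0
  · simp at hb; omega
  · exact h0

theorem no_divisor_chain {k r v c C N M : ℕ} (hk : 2 ≤ k) (hkr : k ≤ r) (hγ : k.gcd r ≤ 8)
    (hv : v = r * (k - 1) + 1) (hdvd : k ∣ v * r)
    (hc : k * (c - 1) = r * N) (hN : Even N) (hC : k * (C - 1) = r * M) (hM : Even M)
    (h1 : 1 < c) (hcC : c ∣ C) (hlt : c < C) (hCv : C ∣ v) (hlt' : C < v) : False := by
  obtain ⟨K, R, hcop, hK, hR⟩ := Nat.exists_coprime k r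
  have hγ0 : 0 < k.gcd r := Nat.gcd_pos_of_pos_left _ (by omega)
  generalize k.gcd r = γ at *
  have hK0 : 0 < K := Nat.pos_of_ne_zero (by rintro rfl; simp at hK; omega)
  have hR0 : 0 < R := Nat.pos_of_ne_zero (by rintro rfl; simp at hR; omega)
  subst hK hR
  have hKR : K ≤ R := Nat.le_of_mul_le_mul_right hkr hγ0
  have cancel : ∀ {e n : ℕ}, K * γ * e = R * γ * n → K * e = R * n := fun {e n} h =>
    Nat.eq_of_mul_eq_mul_right hγ0 (by linarith)
  replace hc := cancel hc
  replace hC := cancel hC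
  have div1 : ∀ {e n : ℕ}, K * e = R * n → R ∣ e := fun {e n} h =>
    hcop.symm.dvd_of_dvd_mul_left ⟨n, h⟩
  have hKv : K ∣ v := by
    have : γ * K ∣ γ * (v * R) := by
      convert hdvd using 1 <;> ring
    exact hcop.dvd_of_dvd_mul_right (Nat.dvd_of_mul_dvd_mul_left hγ0 this)
  obtain ⟨e, rfl⟩ := hcC
  obtain ⟨f, rfl⟩ := hCv
  have he : 1 < e := by
    by_contra h
    interval_cases e <;> omega
  have hf : 1 < f := by
    by_contra h
    interval_cases f <;> omega
  obtain ⟨a, ha0, rfl⟩ := eq_one_add_mul_of_dvd_mul_sub_one (R := R) (m := 1) h1 (by simp) one_pos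
    (by simpa using div1 hc)
  obtain ⟨b, hb0, rfl⟩ := eq_one_add_mul_of_dvd_mul_sub_one he (div1 hc) (by omega) (div1 hC)
  obtain ⟨d, hd0, rfl⟩ := eq_one_add_mul_of_dvd_mul_sub_one hf (div1 hC) (by omega)
    (by rw [hv, Nat.add_sub_cancel]; exact ⟨γ * (K * γ - 1), by ring⟩)
  have hNa : K * a = N := by
    apply Nat.eq_of_mul_eq_mul_left hR0
    rw [← hc, Nat.add_sub_cancel_left]; ring
  have hMb : K * (a + b + R * a * b) = M := by
    apply Nat.eq_of_mul_eq_mul_left hR0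
    rw [← hC, show (1 + R * a) * (1 + R * b) = 1 + R * (a + b + R * a * b) by ring,
      Nat.add_sub_cancel_left]
    ring
  have hv' : (1 + R * a) * (1 + R * b) * (1 + R * d) = 1 + R * (γ * (γ * K - 1)) := by
    rw [hv, mul_comm K γ]; ring
  have hX : γ * (γ * K - 1) + γ = γ * γ * K := by
    have : 1 ≤ γ * K := by nlinarith
    calc γ * (γ * K - 1) + γ = γ * (γ * K - 1 + 1) := by ring
      _ = γ * γ * K := by rw [Nat.sub_add_cancel this]; ring
  set X := γ * (γ * K - 1) with hXdef
  -- Expanding the product and cancelling `R` leaves the elementary symmetric functions of `a`, `b`,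
  -- `d`.
  have hsum : a + b + d + R * (a * b + a * d + b * d) + R * R * (a * b * d) = X := by
    apply Nat.eq_of_mul_eq_mul_left hR0
    have : 1 + R * (a + b + d + R * (a * b + a * d + b * d) + R * R * (a * b * d)) = 1 + R * X := by
      rw [← hv']; ring
    omega
  have hab : 1 ≤ a * b := Nat.mul_pos ha0 hb0
  have had : 1 ≤ a * d := Nat.mul_pos ha0 hd0
  have hbd : 1 ≤ b * d := Nat.mul_pos hb0 hd0
  have habd : 1 ≤ a * b * d := Nat.mul_pos hab hd0
  have hlow : R * R + 3 * R + 3 + γ ≤ γ * γ * K := by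
    have h1 : R * 3 ≤ R * (a * b + a * d + b * d) := Nat.mul_le_mul_left _ (by omega)
    have h2 : R * R * 1 ≤ R * R * (a * b * d) := Nat.mul_le_mul_left _ habd
    omega
  have hup : γ * γ * K ≤ 64 * R := Nat.mul_le_mul (Nat.mul_le_mul hγ hγ) hKR
  -- `R² + 3R + 3 + γ ≤ 64 R` forces `R < 61`.
  have hR61 : R < 61 := by
    by_contra h
    have : R * 61 ≤ R * R := Nat.mul_le_mul_left _ (by omega)
    omega
  -- `s ≥ 17` would give `17 (1 + R²) ≤ 30 R`, against `2 R ≤ 1 + R²`. The expression is symmetric,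
  -- so this serves both `a` and `b`.
  have bound : ∀ s t u : ℕ, 1 ≤ t → 1 ≤ u →
      s + t + u + R * (s * t + s * u + t * u) + R * R * (s * t * u) = X → s < 17 := by
    intro s t u ht hu h
    by_contra hs
    have h1 : s * 1 ≤ s * t := Nat.mul_le_mul_left _ ht
    have h2 : s * 1 ≤ s * u := Nat.mul_le_mul_left _ hu
    have h3 : s * 1 ≤ s * (t * u) := Nat.mul_le_mul_left _ (Nat.mul_pos ht hu)
    have h4 : R * 34 ≤ R * (s * t + s * u + t * u) := Nat.mul_le_mul_left _ (by omega)
    have h5 : R * R * 17 ≤ R * R * (s * t * u) := Nat.mul_le_mul_left _ (by rw [mul_assoc]; omega)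
    have : 17 + 34 * R + 17 * (R * R) ≤ 64 * R := by omega
    have hsq : 2 * R ≤ R * R + 1 := by
      obtain ⟨n, rfl⟩ : ∃ n, R = n + 1 := ⟨R - 1, by omega⟩
      have : (n + 1) * (n + 1) = n * n + 2 * n + 1 := by ring
      omega
    omega
  have ha := bound a b d hb0 hd0 hsum
  have hb := bound b a d ha0 hd0 (by rw [← hsum]; ring)
  refine not_hasParameterChain γ (by omega) R hR61 K (by omega)
    ⟨⟨hKR, hlow, by rw [← hXdef, ← hv']; exact Nat.mod_eq_zero_of_dvd hKv⟩, a, ha, b, hb, ha0, by rw [hNa]; exact Nat.even_iff.1 hN, hb0,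
      by rw [hMb]; exact Nat.even_iff.1 hM, by rw [← hXdef, ← hv']; simp, ?_⟩
  rw [← hXdef, ← hv']
  -- The third factor `1 + R d` exceeds `R`.
  refine Nat.mul_lt_mul_of_pos_left ?_ (by positivity)
  have := Nat.le_mul_of_pos_right R hd0
  omega

/-! ### Counting in linear spaces, and point-transitivity. -/

namespace LinearSpace

variable {P : Type*}

open scoped Classical in
/-- Among the points of `A` other than `p`, each lies on exactly one line through `p`. -/
theorem sum_card_lines_through [Fintype P] (S : LinearSpace P) (p : P) (A : Finset P) :
    ∑ ℓ ∈ S.lines.toFinset with p ∈ ℓ, (A.filter fun q => q ≠ p ∧ q ∈ ℓ).card =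
      (A.filter fun q => q ≠ p).card := by
  have h := Finset.sum_card_bipartiteAbove_eq_sum_card_bipartiteBelow
    (s := S.lines.toFinset.filter fun ℓ => p ∈ ℓ) (t := A.filter fun q => q ≠ p)
    (fun ℓ q => q ∈ ℓ)
  simp only [Finset.bipartiteAbove, Finset.bipartiteBelow, Finset.filter_filter] at h
  rw [h, Finset.card_eq_sum_ones]
  refine Finset.sum_congr rfl fun q hq => ?_
  obtain ⟨ℓ, ⟨h1, h2, h3⟩, huniq⟩ := S.existsUnique_line p q (Finset.mem_filter.1 hq).2.symm
  rw [Finset.card_eq_one]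
  refine ⟨ℓ, Finset.ext fun m => ?_⟩
  simp only [Finset.mem_filter, Set.mem_toFinset, Finset.mem_singleton]
  exact ⟨fun hm => huniq m ⟨hm.1, hm.2.1, hm.2.2⟩, by rintro rfl; exact ⟨h1, h2, h3⟩⟩

theorem ne_univ_of_mem_lines (S : LinearSpace P) (hS : ¬ S.IsTrivial) {ℓ : Set P}
    (hℓ : ℓ ∈ S.lines) : ℓ ≠ Set.univ := by
  rintro rfl
  refine hS (Or.inl ⟨Set.univ, Set.eq_singleton_iff_unique_mem.2 ⟨hℓ, fun m hm => ?_⟩⟩)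
  obtain ⟨p, hp, q, hq, hpq⟩ := S.two_points m hm
  exact (S.existsUnique_line p q hpq).unique ⟨hm, hp, hq⟩ ⟨hℓ, trivial, trivial⟩

theorem two_le_of_hasLineSize [Finite P] (S : LinearSpace P) {k : ℕ} (hk : S.HasLineSize k) :
    2 ≤ k := by
  obtain ⟨ℓ, hℓ⟩ := S.lines_nonempty
  obtain ⟨p, hp, q, hq, hpq⟩ := S.two_points ℓ hℓ
  rw [← hk ℓ hℓ]
  exact (Set.one_lt_ncard (Set.toFinite _)).2 ⟨p, hp, q, hq, hpq⟩

section Counting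

open scoped Classical

variable [Fintype P] (S : LinearSpace P)

theorem card_lines_through {r : ℕ} (hr : S.HasLinesPerPoint r) (p : P) :
    (S.lines.toFinset.filter fun ℓ => p ∈ ℓ).card = r := by
  rw [← hr p, Set.ncard_eq_toFinset_card']
  congr 1
  ext ℓ
  simp

theorem card_points_on {k : ℕ} (hk : S.HasLineSize k) {ℓ : Set P} (hℓ : ℓ ∈ S.lines) :
    (Finset.univ.filter fun p => p ∈ ℓ).card = k := by
  rw [← hk ℓ hℓ, Set.ncard_eq_toFinset_card']
  congr 1
  ext p
  simp

/-- Fisher's inequality, in the form `k ≤ r`. -/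
theorem lineSize_le_linesPerPoint (hS : ¬ S.IsTrivial) {k r : ℕ} (hk : S.HasLineSize k)
    (hr : S.HasLinesPerPoint r) : k ≤ r := by
  obtain ⟨ℓ, hℓ⟩ := S.lines_nonempty
  obtain ⟨p, hp⟩ := (Set.ne_univ_iff_exists_notMem ℓ).1 (S.ne_univ_of_mem_lines hS hℓ)
  -- For `p` off `ℓ`, each of the `r` lines through `p` meets `ℓ` at most once, and together they
  -- cover `ℓ`.
  have h := S.sum_card_lines_through p (Finset.univ.filter fun q => q ∈ ℓ)
  rw [Finset.filter_true_of_mem (p := fun q => q ≠ p), S.card_points_on hk hℓ] at h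
  · rw [← h, ← S.card_lines_through hr p, Finset.card_eq_sum_ones]
    refine Finset.sum_le_sum fun m hm => ?_
    simp only [Finset.mem_filter, Set.mem_toFinset] at hm
    refine Finset.card_le_one.2 fun a ha b hb => ?_
    simp only [Finset.mem_filter, Finset.mem_univ, true_and] at ha hb
    by_contra hab
    have := (S.existsUnique_line a b hab).unique ⟨hm.1, ha.2.2, hb.2.2⟩ ⟨hℓ, ha.1, hb.1⟩
    exact hp (this ▸ hm.2)
  · rintro q hq rfl
    exact hp (Finset.mem_filter.1 hq).2

theorem card_points_sub_one {k r : ℕ} (hk : S.HasLineSize k) (hr : S.HasLinesPerPoint r) (p : P) :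
    Fintype.card P = r * (k - 1) + 1 := by
  have h := S.sum_card_lines_through p Finset.univ
  rw [Finset.sum_congr rfl (g := fun _ => k - 1), Finset.sum_const, S.card_lines_through hr,
    Finset.filter_ne', Finset.card_erase_of_mem (Finset.mem_univ p), Finset.card_univ,
    smul_eq_mul] at h
  · have : 0 < Fintype.card P := Fintype.card_pos_iff.2 ⟨p⟩
    omega
  · intro ℓ hℓ
    simp only [Finset.mem_filter, Set.mem_toFinset] at hℓ
    rw [← S.card_points_on hk hℓ.1, ← Finset.card_erase_of_mem (a := p) (by simpa using hℓ.2)]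
    congr 1
    ext q
    simp

theorem card_lines_mul {k r : ℕ} (hk : S.HasLineSize k) (hr : S.HasLinesPerPoint r) :
    S.lines.toFinset.card * k = Fintype.card P * r := by
  have h := Finset.sum_card_bipartiteAbove_eq_sum_card_bipartiteBelow
    (s := S.lines.toFinset) (t := (Finset.univ : Finset P)) (fun ℓ q => q ∈ ℓ)
  simp only [Finset.bipartiteAbove, Finset.bipartiteBelow] at h
  rwa [Finset.sum_congr rfl fun ℓ hℓ => S.card_points_on hk (Set.mem_toFinset.1 hℓ),
    Finset.sum_congr rfl fun p _ => S.card_lines_through hr p, Finset.sum_const, Finset.sum_const,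
    smul_eq_mul, smul_eq_mul, Finset.card_univ] at h

/-- If every point is equivalent to `c` points and every line carries `N` ordered pairs of distinct
equivalent points, then `k (c - 1) = r N`. -/
theorem lineSize_mul_eq [Nonempty P] {k r c N : ℕ} (hk : S.HasLineSize k)
    (hr : S.HasLinesPerPoint r)
    (E : P → P → Prop) (hE : ∀ p, E p p)
    (hc : ∀ p, (Finset.univ.filter fun q => E p q).card = c)
    (hN : ∀ ℓ ∈ S.lines, (Finset.univ.filter fun x : P × P =>
      x.1 ∈ ℓ ∧ x.2 ∈ ℓ ∧ x.2 ≠ x.1 ∧ E x.1 x.2).card = N) :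
    k * (c - 1) = r * N := by
  have h1 : ∀ p, ∑ ℓ ∈ S.lines.toFinset with p ∈ ℓ,
      (Finset.univ.filter fun q => E p q ∧ q ≠ p ∧ q ∈ ℓ).card = c - 1 := by
    intro p
    have h := S.sum_card_lines_through p (Finset.univ.filter fun q => E p q)
    rw [Finset.filter_ne', Finset.card_erase_of_mem (by simpa using hE p), hc p] at h
    simpa only [Finset.filter_filter] using h
  -- Triples `(p, q, ℓ)` with `p`, `q` distinct, equivalent and on `ℓ`, counted by `p` here and by
  -- `ℓ` in `h3`.
  have h2 : ∑ p : P, ∑ ℓ ∈ S.lines.toFinset with p ∈ ℓ,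
      (Finset.univ.filter fun q => E p q ∧ q ≠ p ∧ q ∈ ℓ).card = Fintype.card P * (c - 1) := by
    simp [h1]
  have h3 : ∀ ℓ ∈ S.lines, ∑ p : P, (if p ∈ ℓ then
      (Finset.univ.filter fun q => E p q ∧ q ≠ p ∧ q ∈ ℓ).card else 0) = N := by
    intro ℓ hℓ
    rw [← hN ℓ hℓ, Finset.card_filter, Fintype.sum_prod_type]
    refine Finset.sum_congr rfl fun p _ => ?_
    rw [← Finset.card_filter]
    split_ifs with hp
    · congr 1; ext q; simp [hp]; tauto
    · simp [hp]
  simp only [Finset.sum_filter] at h2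
  rw [Finset.sum_comm, Finset.sum_congr rfl (g := fun _ => N) fun ℓ hℓ =>
    h3 ℓ (by simpa using hℓ), Finset.sum_const, smul_eq_mul] at h2
  have h4 := S.card_lines_mul hk hr
  have h5 : 0 < Fintype.card P := Fintype.card_pos
  apply Nat.eq_of_mul_eq_mul_left h5
  calc Fintype.card P * (k * (c - 1)) = k * (Fintype.card P * (c - 1)) := by ring
    _ = (S.lines.toFinset.card * k) * N := by rw [← h2]; ring
    _ = Fintype.card P * (r * N) := by rw [h4]; ring

end Counting

/-- A line-transitive group of a linear space with more than one line is point-transitive. -/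
theorem exists_apply_eq_of_isLineTransitive [Finite P] (S : LinearSpace P) (hS : ¬ S.IsTrivial)
    (G : Subgroup (Equiv.Perm P)) (hGL : S.IsLineTransitive G) {k r : ℕ}
    (hk : S.HasLineSize k) (hr : S.HasLinesPerPoint r) (a b : P) : ∃ g ∈ G, g a = b := by
  classical
  have := Fintype.ofFinite P
  by_contra hab
  let A : Finset P := Finset.univ.filter fun q => ∃ g ∈ G, g a = q
  have hA : ∀ g ∈ G, ∀ q, g q ∈ A ↔ q ∈ A := by
    intro g hg q
    simp only [A, Finset.mem_filter, Finset.mem_univ, true_and]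
    constructor
    · rintro ⟨h, hh, e⟩
      exact ⟨g⁻¹ * h, G.mul_mem (G.inv_mem hg) hh, by simp [e]⟩
    · rintro ⟨h, hh, e⟩
      exact ⟨g * h, G.mul_mem hg hh, by simp [e]⟩
  obtain ⟨ℓ₀, hℓ₀⟩ := S.lines_nonempty
  set m := (A.filter fun q => q ∈ ℓ₀).card with hm
  have hconst : ∀ ℓ ∈ S.lines, (A.filter fun q => q ∈ ℓ).card = m := by
    intro ℓ hℓ
    obtain ⟨g, hg, rfl⟩ := hGL ℓ₀ hℓ₀ ℓ hℓ
    rw [hm]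
    symm
    refine Finset.card_bij (fun q _ => g q) ?_ (fun _ _ _ _ h => g.injective h) ?_
    · intro q hq
      rw [Finset.mem_filter] at hq ⊢
      exact ⟨(hA g hg q).2 hq.1, q, hq.2, rfl⟩
    · intro q hq
      rw [Finset.mem_filter] at hq
      obtain ⟨hq, p, hp, rfl⟩ := hq
      exact ⟨p, Finset.mem_filter.2 ⟨(hA g hg p).1 hq, hp⟩, rfl⟩
  have hbA : b ∉ A := by simpa [A] using hab
  have haA : a ∈ A := by simpa [A] using ⟨1, G.one_mem, rfl⟩
  -- The orbit `A` meets every line in `m` points. Counting `A` from `b ∉ A` gives `|A| = r m`, and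
  -- from `a ∈ A` gives `|A| - 1 = r (m - 1)`. Hence `r = 1`, against `2 ≤ k ≤ r`.
  have hb := S.sum_card_lines_through b A
  have ha := S.sum_card_lines_through a A
  rw [Finset.sum_congr rfl (g := fun _ => m), Finset.sum_const, S.card_lines_through hr,
    Finset.filter_ne', Finset.erase_eq_of_notMem hbA, smul_eq_mul] at hb
  · rw [Finset.sum_congr rfl (g := fun _ => m - 1), Finset.sum_const, S.card_lines_through hr,
      Finset.filter_ne', Finset.card_erase_of_mem haA, smul_eq_mul, ← hb] at ha
    · have hr2 := (S.two_le_of_hasLineSize hk).trans (S.lineSize_le_linesPerPoint hS hk hr)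
      have hpos : 0 < r * m := hb ▸ Finset.card_pos.2 ⟨a, haA⟩
      obtain ⟨m', hm'⟩ : ∃ m', m = m' + 1 := ⟨m - 1, by have := Nat.pos_of_mul_pos_left hpos; omega⟩
      rw [hm', Nat.add_sub_cancel, Nat.mul_succ] at ha
      omega
    · intro ℓ hℓ
      simp only [Finset.mem_filter, Set.mem_toFinset] at hℓ
      rw [← hconst ℓ hℓ.1, ← Finset.card_erase_of_mem (a := a)
        (Finset.mem_filter.2 ⟨haA, hℓ.2⟩)]
      congr 1
      ext q
      simp only [Finset.mem_filter, Finset.mem_erase]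
      tauto
  · intro ℓ hℓ
    simp only [Finset.mem_filter, Set.mem_toFinset] at hℓ
    rw [← hconst ℓ hℓ.1]
    congr 1
    ext q
    simp only [Finset.mem_filter]
    refine ⟨fun h => ⟨h.1, h.2.2⟩, fun h => ⟨h.1, ?_, h.2⟩⟩
    rintro rfl
    exact hbA h.1

end LinearSpace

/-! ### Invariant partitions and their class sizes. -/

namespace PointPartition

variable {X : Type*}

/-- Two points are related by a partition if they lie in a common class. -/
def SameClass (𝒞 : Set (Set X)) (p q : X) : Prop := ∃ C ∈ 𝒞, p ∈ C ∧ q ∈ C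

theorem eq_of_mem_of_mem {𝒞 : Set (Set X)} (h : Setoid.IsPartition 𝒞) {C D : Set X} (hC : C ∈ 𝒞)
    (hD : D ∈ 𝒞) {p : X} (hpC : p ∈ C) (hpD : p ∈ D) : C = D :=
  (h.2 p).unique ⟨hC, hpC⟩ ⟨hD, hpD⟩

theorem sameClass_iff {𝒞 : Set (Set X)} (h : Setoid.IsPartition 𝒞) {C : Set X} (hC : C ∈ 𝒞)
    {p q : X} (hp : p ∈ C) : SameClass 𝒞 p q ↔ q ∈ C := by
  refine ⟨?_, fun hq => ⟨C, hC, hp, hq⟩⟩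
  rintro ⟨D, hD, hpD, hqD⟩
  rwa [eq_of_mem_of_mem h hC hD hp hpD]

theorem sameClass_refl {𝒞 : Set (Set X)} (h : Setoid.IsPartition 𝒞) (p : X) : SameClass 𝒞 p p := by
  obtain ⟨C, ⟨hC, hp⟩, -⟩ := h.2 p
  exact ⟨C, hC, hp, hp⟩

theorem sameClass_symm {𝒞 : Set (Set X)} {p q : X} (h : SameClass 𝒞 p q) : SameClass 𝒞 q p := by
  obtain ⟨C, hC, hp, hq⟩ := h
  exact ⟨C, hC, hq, hp⟩

theorem sameClass_apply_iff {G : Subgroup (Equiv.Perm X)} {𝒞 : Set (Set X)}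
    (h : IsInvariantPartition G 𝒞) {g : Equiv.Perm X} (hg : g ∈ G) (p q : X) :
    SameClass 𝒞 (g p) (g q) ↔ SameClass 𝒞 p q := by
  have key : ∀ f ∈ G, ∀ a b, SameClass 𝒞 a b → SameClass 𝒞 (f a) (f b) := by
    rintro f hf a b ⟨C, hC, ha, hb⟩
    exact ⟨f '' C, h.2 f hf C hC, ⟨a, ha, rfl⟩, ⟨b, hb, rfl⟩⟩
  exact ⟨fun hpq => by simpa using key g⁻¹ (G.inv_mem hg) _ _ hpq, key g hg p q⟩

theorem ncard_eq_ncard_of_transitive {G : Subgroup (Equiv.Perm X)} {𝒞 : Set (Set X)}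
    (h : IsInvariantPartition G 𝒞) (hG : ∀ a b : X, ∃ g ∈ G, g a = b) {C D : Set X} (hC : C ∈ 𝒞)
    (hD : D ∈ 𝒞) : C.ncard = D.ncard := by
  obtain ⟨a, ha⟩ := Setoid.nonempty_of_mem_partition h.1 hC
  obtain ⟨b, hb⟩ := Setoid.nonempty_of_mem_partition h.1 hD
  obtain ⟨g, hg, rfl⟩ := hG a b
  rw [← eq_of_mem_of_mem h.1 (h.2 g hg C hC) hD ⟨a, ha, rfl⟩ hb,
    Set.ncard_image_of_injective _ g.injective]

/-- A union of classes of size `c` has cardinality divisible by `c`. -/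
theorem dvd_ncard_of_forall_subset [Finite X] {𝒞 : Set (Set X)} (h : Setoid.IsPartition 𝒞) {c : ℕ}
    (hc : ∀ C ∈ 𝒞, C.ncard = c) {U : Set X}
    (hU : ∀ C ∈ 𝒞, ∀ p ∈ C, p ∈ U → C ⊆ U) : c ∣ U.ncard := by
  classical
  have := Fintype.ofFinite X
  choose cls hcls using fun p => (h.2 p).exists
  -- The fibres of `cls` on `U` are whole classes, as `U` is a union of classes.
  rw [Set.ncard_eq_toFinset_card', Finset.card_eq_sum_card_image cls]
  refine Finset.dvd_sum fun D hD => ?_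
  obtain ⟨p, hp, rfl⟩ := Finset.mem_image.1 hD
  rw [← hc _ (hcls p).1, Set.ncard_eq_toFinset_card']
  refine dvd_of_eq (congrArg _ (Finset.ext fun q => ?_))
  simp only [Set.mem_toFinset, Finset.mem_filter] at hp ⊢
  refine ⟨fun hq => ⟨hU _ (hcls p).1 p (hcls p).2 hp hq, ?_⟩, ?_⟩
  · exact eq_of_mem_of_mem h (hcls q).1 (hcls p).1 (hcls q).2 hq
  · rintro ⟨-, hq⟩
    exact hq ▸ (hcls q).2

theorem eq_discrete_of_ncard_eq_one {𝒞 : Set (Set X)} (h : Setoid.IsPartition 𝒞)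
    (hc : ∀ C ∈ 𝒞, C.ncard = 1) : 𝒞 = discrete X := by
  ext C
  constructor
  · exact fun hC => Set.ncard_eq_one.1 (hc C hC)
  · rintro ⟨a, rfl⟩
    obtain ⟨D, ⟨hD, haD⟩, -⟩ := h.2 a
    obtain ⟨b, rfl⟩ := Set.ncard_eq_one.1 (hc D hD)
    rwa [Set.mem_singleton_iff.1 haD]

theorem eq_allInOne_of_univ_mem [Nonempty X] {𝒞 : Set (Set X)} (h : Setoid.IsPartition 𝒞)
    (hu : Set.univ ∈ 𝒞) : 𝒞 = allInOne X := by
  refine Set.eq_singleton_iff_unique_mem.2 ⟨hu, fun C hC => ?_⟩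
  obtain ⟨a, ha⟩ := Setoid.nonempty_of_mem_partition h hC
  exact eq_of_mem_of_mem h hC hu ha trivial

theorem eq_of_refines_of_subset {𝒞 𝒟 : Set (Set X)} (h𝒞 : Setoid.IsPartition 𝒞)
    (h𝒟 : Setoid.IsPartition 𝒟) (h : ∀ C ∈ 𝒞, C ∈ 𝒟) : 𝒞 = 𝒟 := by
  refine Set.Subset.antisymm h fun D hD => ?_
  obtain ⟨a, ha⟩ := Setoid.nonempty_of_mem_partition h𝒟 hD
  obtain ⟨C, ⟨hC, haC⟩, -⟩ := h𝒞.2 a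
  rwa [← eq_of_mem_of_mem h𝒟 (h C hC) hD haC ha]

end PointPartition

/-! ### Excluding chains of invariant partitions. -/

namespace LinearSpace

open PointPartition

variable {P : Type*}

/-- In a line-transitive linear space, `k (c - 1) = r N` for a `G`-invariant partition with classes
of size `c`, where `N` is the number of ordered inner pairs on a line; in particular `N` is even. -/
theorem exists_even_mul_eq [Finite P] [Nonempty P] (S : LinearSpace P)
    (G : Subgroup (Equiv.Perm P)) (hGL : S.IsLineTransitive G) {k r : ℕ} (hk : S.HasLineSize k)
    (hr : S.HasLinesPerPoint r) {𝒞 : Set (Set P)} (h𝒞 : IsInvariantPartition G 𝒞) {c : ℕ}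
    (hc : ∀ C ∈ 𝒞, C.ncard = c) : ∃ N, Even N ∧ k * (c - 1) = r * N := by
  classical
  have := Fintype.ofFinite P
  let F : Set P → Finset (P × P) := fun ℓ => Finset.univ.filter fun x : P × P =>
      x.1 ∈ ℓ ∧ x.2 ∈ ℓ ∧ x.2 ≠ x.1 ∧ SameClass 𝒞 x.1 x.2
  have hF : ∀ ℓ x, x ∈ F ℓ ↔ x.1 ∈ ℓ ∧ x.2 ∈ ℓ ∧ x.2 ≠ x.1 ∧ SameClass 𝒞 x.1 x.2 := by
    intro ℓ x
    simp [F]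
  obtain ⟨ℓ₀, hℓ₀⟩ := S.lines_nonempty
  refine ⟨(F ℓ₀).card, ?_, S.lineSize_mul_eq hk hr (SameClass 𝒞) (sameClass_refl h𝒞.1) ?_ ?_⟩
  -- Swapping the two points is a fixed-point-free involution on the pairs, so their number vanishes
  -- in `ZMod 2`.
  · rw [Nat.even_iff, ← Nat.dvd_iff_mod_eq_zero, ← CharP.cast_eq_zero_iff (ZMod 2) 2,
      Finset.card_eq_sum_ones, Nat.cast_sum]
    refine Finset.sum_involution (fun x _ => x.swap) ?_ ?_ ?_ ?_
    · intro _ _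
      decide
    · rintro ⟨p, q⟩ hx - heq
      exact ((hF _ _).1 hx).2.2.1 (congrArg Prod.fst heq)
    · intro x hx
      rw [hF] at hx ⊢
      exact ⟨hx.2.1, hx.1, hx.2.2.1.symm, sameClass_symm hx.2.2.2⟩
    · exact fun x _ => x.swap_swap
  · intro p
    obtain ⟨C, ⟨hC, hp⟩, -⟩ := h𝒞.1.2 p
    rw [← hc C hC, Set.ncard_eq_toFinset_card']
    congr 1
    ext q
    simp [sameClass_iff h𝒞.1 hC hp]
  · intro ℓ hℓ
    obtain ⟨g, hg, rfl⟩ := hGL ℓ₀ hℓ₀ ℓ hℓ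
    suffices h : F (g '' ℓ₀) = (F ℓ₀).map (g.prodCongr g).toEmbedding by
      exact (congrArg Finset.card h).trans (Finset.card_map _)
    ext ⟨p, q⟩
    simp only [hF, Finset.mem_map_equiv, Equiv.prodCongr_symm, Equiv.prodCongr_apply, Prod.map,
      Set.mem_image_equiv, ne_eq, EmbeddingLike.apply_eq_iff_eq]
    rw [← sameClass_apply_iff h𝒞 hg (g.symm p), g.apply_symm_apply, g.apply_symm_apply]

/-- There is no chain of two distinct non-trivial invariant partitions. -/
theorem eq_of_refines [Finite P] (S : LinearSpace P) (hS : ¬ S.IsTrivial)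
    (G : Subgroup (Equiv.Perm P)) (hGL : S.IsLineTransitive G)
    {k r : ℕ} (hk : S.HasLineSize k) (hr : S.HasLinesPerPoint r) (hkr : Nat.gcd k r ≤ 8)
    {𝒞 𝒟 : Set (Set P)} (h𝒞 : IsInvariantPartition G 𝒞) (h𝒟 : IsInvariantPartition G 𝒟)
    (h𝒞' : 𝒞 ≠ discrete P) (h𝒟' : 𝒟 ≠ allInOne P) (href : Refines 𝒞 𝒟) : 𝒞 = 𝒟 := by
  have hG := S.exists_apply_eq_of_isLineTransitive hS G hGL hk hr
  obtain ⟨ℓ, hℓ⟩ := S.lines_nonempty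
  obtain ⟨a, -⟩ := S.two_points ℓ hℓ
  have : Nonempty P := ⟨a⟩
  have := Fintype.ofFinite P
  obtain ⟨C, ⟨hC, haC⟩, -⟩ := h𝒞.1.2 a
  obtain ⟨D, ⟨hD, haD⟩, -⟩ := h𝒟.1.2 a
  have hc : ∀ C' ∈ 𝒞, C'.ncard = C.ncard := fun C' hC' => ncard_eq_ncard_of_transitive h𝒞 hG hC' hC
  have hd : ∀ D' ∈ 𝒟, D'.ncard = D.ncard := fun D' hD' => ncard_eq_ncard_of_transitive h𝒟 hG hD' hD
  -- Each class of `𝒟` is a union of classes of `𝒞`, whence `c ∣ C`.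
  have hsub : ∀ C' ∈ 𝒞, ∀ D' ∈ 𝒟, ∀ p ∈ C', p ∈ D' → C' ⊆ D' := by
    intro C' hC' D' hD' p hpC hpD
    obtain ⟨E, hE, hsub⟩ := href C' hC'
    rwa [eq_of_mem_of_mem h𝒟.1 hD' hE hpD (hsub hpC)]
  obtain ⟨N, hN, hNeq⟩ := S.exists_even_mul_eq G hGL hk hr h𝒞 hc
  obtain ⟨M, hM, hMeq⟩ := S.exists_even_mul_eq G hGL hk hr h𝒟 hd
  by_contra hne
  refine no_divisor_chain (S.two_le_of_hasLineSize hk) (S.lineSize_le_linesPerPoint hS hk hr) hkr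
    (S.card_points_sub_one hk hr a) (Dvd.intro_left _ (S.card_lines_mul hk hr))
    hNeq hN hMeq hM ?_ ?_ ?_ ?_ ?_
  · have h0 : 0 < C.ncard := (Set.ncard_pos (Set.toFinite _)).2 ⟨a, haC⟩
    have h1 : C.ncard ≠ 1 := fun h => h𝒞' (eq_discrete_of_ncard_eq_one h𝒞.1 (by simpa [h] using hc))
    omega
  · exact dvd_ncard_of_forall_subset h𝒞.1 hc fun C' hC' p hp hpD => hsub C' hC' D hD p hp hpD
  · by_contra hlt
    refine hne (eq_of_refines_of_subset h𝒞.1 h𝒟.1 fun C' hC' => ?_)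
    obtain ⟨D', hD', hsub'⟩ := href C' hC'
    rwa [Set.eq_of_subset_of_ncard_le hsub' (by rw [hc C' hC', hd D' hD']; omega) (Set.toFinite _)]
  · rw [← Nat.card_eq_fintype_card, ← Set.ncard_univ]
    exact dvd_ncard_of_forall_subset h𝒟.1 hd fun _ _ _ _ _ => Set.subset_univ _
  · by_contra hlt
    refine h𝒟' (eq_allInOne_of_univ_mem h𝒟.1 ?_)
    rw [← Nat.card_eq_fintype_card, ← Set.ncard_univ, not_lt] at hlt
    rwa [← Set.eq_of_subset_of_ncard_le (Set.subset_univ D) hlt (Set.toFinite _)]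

end LinearSpace

theorem theorem4p9 {P : Type*} [Finite P] (S : LinearSpace P) (hS : ¬ S.IsTrivial)
    (G : Subgroup (Equiv.Perm P)) (hG : G ≤ S.aut) (hGL : S.IsLineTransitive G)
    (𝒞 : Set (Set P)) (h𝒞 : PointPartition.IsInvariantPartition G 𝒞)
    (h𝒞' : PointPartition.IsNontrivial 𝒞)
    (k r : ℕ) (hk : S.HasLineSize k) (hr : S.HasLinesPerPoint r)
    (hkr : Nat.gcd k r ≤ 8) :
    PointPartition.IsTwoStepImprimitive G 𝒞 := by
  refine ⟨S.exists_apply_eq_of_isLineTransitive hS G hGL hk hr, h𝒞, h𝒞', ?_, ?_⟩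
  -- Minimality takes `𝒞` as the coarser member of the chain, maximality as the finer.
  · intro 𝒟 h𝒟 href hne
    by_contra hd
    exact hne (S.eq_of_refines hS G hGL hk hr hkr h𝒟 h𝒞 hd h𝒞'.2 href)
  · intro 𝒟 h𝒟 href hne
    by_contra hd
    exact hne (S.eq_of_refines hS G hGL hk hr hkr h𝒞 h𝒟 h𝒞'.1 hd href).symm
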